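/- Let $R$ be a commutative noetherian ring, let $\operatorname{mod} R$ be the abelian category of finitely generated $R$-modules, and let $\mathcal{X}$ be a torsionfree class of $\operatorname{mod} R$, i.e. an additive (full, isomorphism-closed) subcategory closed under subobjects and extensions. For a subcategory $\mathcal{S}$ of $\operatorname{mod} R$ and a subset $\Phi \subseteq \operatorname{Spec} R$ put $$\operatorname{Ass}\mathcal{S} := \bigcup_{M\in\mathcal{S}} \operatorname{Ass} M, \qquad \operatorname{mod}^{\mathrm{ass}}_{\Phi} R := \{M \in \operatorname{mod} R \mid \operatorname{Ass} M \subseteq \Phi\}.$$ A Serre subcategory of $\mathcal{X}$ is an additive subcategory $\mathcal{S}$ of $\mathcal{X}$ such that for every short exact sequence $0 \to A \to B \to C \to 0$ in $\operatorname{mod} R$ with $A, B, C \in \mathcal{X}$, one has $B \in \mathcal{S}$ if and only if both $A \in \mathcal{S}$ and $C \in \mathcal{S}$. Then the assignments $\mathcal{S} \mapsto \operatorname{Ass}\mathcal{S}$ and $\Phi \mapsto \operatorname{mod}^{\mathrm{ass}}_{\Phi} R$ give rise to mutually inverse bijections between * the set of Serre subcategories of $\mathcal{X}$, and * the set of specialization-closed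 subsets of $\operatorname{Ass}\mathcal{X}$, where $\operatorname{Ass}\mathcal{X}$ carries the relative topology induced from $\operatorname{Spec} R$. -/

import Mathlib

open CategoryTheory

universe v u

section Subcategories

variable {C : Type u} [Category.{v} C] [Abelian C]

/-- An additive subcategory of an abelian category: a full subcategory closed under isomorphisms,
containing the zero object and closed under finite direct sums. -/
structure IsAdditiveSubcategory (P : ObjectProperty C) : Prop where
  closedUnderIsomorphisms : P.IsClosedUnderIsomorphisms
  containsZero : P.ContainsZero
  biprod_mem : ∀ M N : C, P M → P N → P (M ⊞ N)

/-- A torsionfree class of an abelian category: an additive subcategory closed under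
subobjects and extensions. -/
structure IsTorsionfreeClass (X : ObjectProperty C) : Prop where
  additive : IsAdditiveSubcategory X
  closedUnderSubobjects : X.IsClosedUnderSubobjects
  closedUnderExtensions : X.IsClosedUnderExtensions

/-- A conflation of a subcategory `X` of an abelian category: a short exact sequence of the
ambient category whose three terms all belong to `X`. -/
structure IsConflation (X : ObjectProperty C) (T : ShortComplex C) : Prop where
  shortExact : T.ShortExact
  left_mem : X T.X₁
  middle_mem : X T.X₂
  right_mem : X T.X₃

/-- A Serre subcategory of an extension-closed subcategory `X` of an abelian category:
an additive subcategory `S` of `X` such that for each conflation `0 → A → B → C → 0` of `X`,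
`B` is in `S` if and only if both `A` and `C` are in `S`. -/
structure IsSerreSubcategoryOf (X S : ObjectProperty C) : Prop where
  le : S ≤ X
  additive : IsAdditiveSubcategory S
  mem_iff_of_conflation : ∀ T : ShortComplex C, IsConflation X T → (S T.X₂ ↔ S T.X₁ ∧ S T.X₃)

end Subcategories

/-- `Φ` is a specialization-closed subset of the subspace `A` of a topological space: it is
contained in `A`, and it is stable under specialization for the relative topology on `A`. -/
def IsSpecializationClosedIn {T : Type u} [TopologicalSpace T] (A Φ : Set T) : Prop :=
  Φ ⊆ A ∧ StableUnderSpecialization {x : A | (x : T) ∈ Φ}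

section AssociatedPrimes

variable (R : Type u) [CommRing R]

/-- `Ass M`, as a subset of `Spec R`. -/
def moduleAss (M : FGModuleCat.{u} R) : Set (PrimeSpectrum R) :=
  {p | IsAssociatedPrime p.asIdeal M}

/-- `Ass X`, the union of the `Ass M` for `M` in the subcategory `X` of finitely generated
modules. -/
def subcategoryAss (X : ObjectProperty (FGModuleCat.{u} R)) : Set (PrimeSpectrum R) :=
  {p | ∃ M : FGModuleCat.{u} R, X M ∧ p ∈ moduleAss R M}

/-- The subcategory of the finitely generated modules `M` such that `Ass M ⊆ Φ`. -/
def modAss (Φ : Set (PrimeSpectrum R)) : ObjectProperty (FGModuleCat.{u} R) :=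
  fun M => moduleAss R M ⊆ Φ

end AssociatedPrimes

/-! Everything rests on one fact: if `q` contains the annihilator of a finite module `L`, then `L`
has a nonzero map to `R ⧸ q`, whose image has `q` as its only associated prime. Since `R ⧸ q` embeds
in an object of `X` when `q ∈ Ass X`, this image is a quotient of `L` inside `X`, so `Ass S` is
specialization-closed in `Ass X`. The same maps recover `S` from `Ass S`: a submodule of `M` maximal
among those in `S` could be enlarged unless it is all of `M`. -/

/-! ### Maps to `R ⧸ p` and associated primes. -/

section CommutativeAlgebra

variable {R : Type u} [CommRing R] {M : Type u} [AddCommGroup M] [Module R M]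

/-- By hypothesis `x` survives in the vector space `(M / pM) ⊗ Frac(R / p)`. Some functional detects
it there, and clearing denominators makes the functional take values in `R ⧸ p`. -/
theorem exists_linearMap_quotient_prime_apply_ne_zero [IsNoetherianRing R] [Module.Finite R M]
    (p : Ideal R) [p.IsPrime] (x : M) (hx : ∀ s ∉ p, s • x ∉ (p • ⊤ : Submodule R M)) :
    ∃ f : M →ₗ[R] R ⧸ p, f x ≠ 0 := by
  let D := R ⧸ p
  let T := M ⧸ (p • ⊤ : Submodule R M)
  let K := FractionRing D
  let S := nonZeroDivisors D
  let ι := LocalizedModule.mkLinearMap S T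
  let y : T := Submodule.Quotient.mk x
  have hy : ι y ≠ 0 := by
    intro h
    rw [IsLocalizedModule.eq_zero_iff S ι] at h
    obtain ⟨⟨c, hc⟩, h⟩ := h
    obtain ⟨s, rfl⟩ := Ideal.Quotient.mk_surjective c
    refine hx s (fun hs => nonZeroDivisors.ne_zero hc (Ideal.Quotient.eq_zero_iff_mem.mpr hs)) ?_
    exact (Submodule.Quotient.mk_eq_zero _).mp h
  have hφ : ∃ φ : Module.Dual K (LocalizedModule S T), φ (ι y) ≠ 0 := by
    by_contra! h
    exact hy ((Module.forall_dual_apply_eq_zero_iff K _).mp h)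
  obtain ⟨φ, hφ⟩ := hφ
  have : Module.Finite D T := Module.Finite.of_restrictScalars_finite R D T
  have : Module.FinitePresentation D T := Module.finitePresentation_of_finite D T
  obtain ⟨g, s, hg⟩ := Module.FinitePresentation.exists_lift_of_isLocalizedModule S
    (Algebra.linearMap D K) ((φ.restrictScalars D) ∘ₗ ι)
  refine ⟨(g.restrictScalars R) ∘ₗ (p • ⊤ : Submodule R M).mkQ, fun h => ?_⟩
  have h' : g y = 0 := h
  have h2 := congr($hg y)
  rw [LinearMap.comp_apply, h', map_zero] at h2
  have h3 : (s : D) • φ (ι y) = 0 := h2.symm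
  rw [smul_eq_zero] at h3
  exact h3.elim (nonZeroDivisors.ne_zero s.2) hφ

theorem exists_linearMap_quotient_prime_ne_zero [IsNoetherianRing R] [Module.Finite R M]
    (p : Ideal R) [hp : p.IsPrime] (h : Module.annihilator R M ≤ p) :
    ∃ f : M →ₗ[R] R ⧸ p, f ≠ 0 := by
  have : (⟨p, hp⟩ : PrimeSpectrum R) ∈ Module.support R (M ⧸ (p • ⊤ : Submodule R M)) := by
    rw [Module.support_quotient, Module.support_eq_zeroLocus]
    exact ⟨h, le_refl p⟩
  obtain ⟨m, hm⟩ := Module.mem_support_iff'.mp this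
  obtain ⟨x, rfl⟩ := Submodule.mkQ_surjective _ m
  obtain ⟨f, hf⟩ := exists_linearMap_quotient_prime_apply_ne_zero p x
    (fun s hs hx => hm s hs ((Submodule.Quotient.mk_eq_zero _).mpr hx))
  exact ⟨f, fun h => hf (by simp [h])⟩

theorem IsAssociatedPrime.module_annihilator_le {p : Ideal R} (h : IsAssociatedPrime p M) :
    Module.annihilator R M ≤ p := by
  rw [← Submodule.annihilator_top]
  exact h.annihilator_le

theorem exists_isAssociatedPrime_le [IsNoetherianRing R] [Module.Finite R M]
    (q : Ideal R) [q.IsPrime] (h : Module.annihilator R M ≤ q) :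
    ∃ p ≤ q, IsAssociatedPrime p M := by
  obtain ⟨p, hp, hpq⟩ := Ideal.exists_minimalPrimes_le h
  exact ⟨p, hpq, Module.associatedPrimes.minimalPrimes_annihilator_subset_associatedPrimes R M hp⟩

theorem IsAssociatedPrime.eq_of_quotient_prime [IsNoetherianRing R] {p q : Ideal R} [hp : p.IsPrime]
    (h : IsAssociatedPrime q (R ⧸ p)) : q = p := by
  rw [h.eq_radical hp.isPrimary, hp.radical]

theorem isAssociatedPrime_range_quotient_prime [IsNoetherianRing R] (q : Ideal R) [q.IsPrime]
    (f : M →ₗ[R] R ⧸ q) (hf : f ≠ 0) : IsAssociatedPrime q (LinearMap.range f) := by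
  have : Nontrivial (LinearMap.range f) :=
    Submodule.nontrivial_iff_ne_bot.mpr (by rwa [ne_eq, LinearMap.range_eq_bot])
  obtain ⟨p, hp⟩ := associatedPrimes.nonempty R (LinearMap.range f)
  have hpq : p = q := (hp.map_of_injective (LinearMap.range f).subtype
    Subtype.val_injective).eq_of_quotient_prime
  exact hpq ▸ hp

theorem IsAssociatedPrime.of_quotient_torsionBySet [IsNoetherianRing R] {p q : Ideal R}
    (h : IsAssociatedPrime q (M ⧸ Submodule.torsionBySet R M p)) : IsAssociatedPrime q M := by
  obtain ⟨hq, m, hm⟩ := isAssociatedPrime_iff.mp h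
  obtain ⟨x, rfl⟩ := Submodule.mkQ_surjective _ m
  -- The annihilator of the class of `x` is the finite intersection of the annihilators of `a • x`,
  -- `a` running over generators of `p`. Being prime, it equals one of them.
  obtain ⟨s, hs⟩ := (isNoetherianRing_iff_ideal_fg R).mp ‹_› p
  have key : s.inf (fun a => (⊥ : Submodule R M).colon {a • x}) = q := by
    ext r
    rw [hm, Submodule.mem_colon_singleton, ← map_smul, Submodule.mem_bot, Submodule.mkQ_apply,
      Submodule.Quotient.mk_eq_zero, ← hs,
      ← Submodule.torsionBySet_eq_torsionBySet_span,
      Submodule.mem_torsionBySet_iff, Submodule.mem_finsetInf]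
    simp only [Submodule.mem_colon_singleton, Submodule.mem_bot, Subtype.forall, SetLike.mem_coe]
    simp only [smul_comm r]
  obtain ⟨a, ha, haq⟩ := (Ideal.IsPrime.inf_le' hq).mp key.le
  refine isAssociatedPrime_iff.mpr ⟨hq, a • x, le_antisymm ?_ haq⟩
  rw [← key]
  exact Finset.inf_le ha

/-- Such an `M` is torsion-free over `R ⧸ p`, so maps to `R ⧸ p` separate its points; finitely many
generators of the Hom module suffice. -/
theorem exists_injective_pi_quotient_prime [IsNoetherianRing R] [Module.Finite R M]
    (p : Ideal R) [p.IsPrime] (hM : ∀ a ∈ p, ∀ x : M, a • x = 0)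
    (hp : ∀ q, IsAssociatedPrime q M → q = p) :
    ∃ (n : ℕ) (f : M →ₗ[R] (Fin n → R ⧸ p)), Function.Injective f := by
  have hbot : (p • ⊤ : Submodule R M) = ⊥ :=
    le_bot_iff.mp (Submodule.smul_le.mpr fun a ha x _ => by simp [hM a ha x])
  have hsep : ∀ x : M, x ≠ 0 → ∃ f : M →ₗ[R] R ⧸ p, f x ≠ 0 := fun x hx => by
    refine exists_linearMap_quotient_prime_apply_ne_zero p x fun s hs hsx => hs ?_
    obtain ⟨q, hq, hle⟩ := exists_le_isAssociatedPrime_of_isNoetherianRing (R := R) x hx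
    rw [← hp q hq]
    rw [hbot] at hsx
    exact hle (Submodule.mem_colon_singleton.mpr hsx)
  obtain ⟨n, g, hg⟩ := Module.Finite.exists_fin (R := R) (M := M →ₗ[R] R ⧸ p)
  refine ⟨n, LinearMap.pi g, (injective_iff_map_eq_zero _).mpr fun x hx => ?_⟩
  by_contra hne
  obtain ⟨f, hf⟩ := hsep x hne
  have hle : Submodule.span R (Set.range g) ≤ LinearMap.ker (LinearMap.applyₗ (R := R) x) := by
    rw [Submodule.span_le]
    rintro _ ⟨i, rfl⟩
    exact congrFun hx i
  exact hf (hle (hg ▸ Submodule.mem_top : f ∈ _))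

end CommutativeAlgebra

/-! ### Short exact sequences and closure properties. -/

section Subcategories

variable {R : Type u} [CommRing R] [IsNoetherianRing R]

theorem FGModuleCat.shortExact_iff (T : ShortComplex (FGModuleCat.{u} R)) :
    T.ShortExact ↔ Function.Injective T.f.hom.hom ∧ Function.Exact T.f.hom.hom T.g.hom.hom ∧
      Function.Surjective T.g.hom.hom := by
  let F := forget₂ (FGModuleCat.{u} R) (ModuleCat.{u} R)
  constructor
  · intro h
    have h' := h.map_of_exact F
    exact ⟨h'.moduleCat_injective_f,
      (ShortComplex.ShortExact.moduleCat_exact_iff_function_exact _).mp h'.exact,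
      h'.moduleCat_surjective_g⟩
  · rintro ⟨h1, h2, h3⟩
    refine ShortComplex.ShortExact.mk' ?_ ?_ ?_
    · exact (T.exact_map_iff_of_faithful F).mp
        ((ShortComplex.ShortExact.moduleCat_exact_iff_function_exact _).mpr h2)
    · have : Mono (F.map T.f) := (ModuleCat.mono_iff_injective _).mpr h1
      exact F.mono_of_mono_map this
    · have : Epi (F.map T.g) := (ModuleCat.epi_iff_surjective _).mpr h3
      exact F.epi_of_epi_map this

variable {A B D : Type u} [AddCommGroup A] [AddCommGroup B] [AddCommGroup D]
  [Module R A] [Module R B] [Module R D] [Module.Finite R A] [Module.Finite R B]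
  [Module.Finite R D]

/-- The short complex of finitely generated modules given by two composable linear maps. -/
abbrev FGModuleCat.shortComplex (f : A →ₗ[R] B) (g : B →ₗ[R] D) (h : Function.Exact f g) :
    ShortComplex (FGModuleCat.{u} R) where
  X₁ := FGModuleCat.of R A
  X₂ := FGModuleCat.of R B
  X₃ := FGModuleCat.of R D
  f := FGModuleCat.ofHom f
  g := FGModuleCat.ofHom g
  zero := FGModuleCat.hom_ext h.linearMap_comp_eq_zero

theorem FGModuleCat.shortComplex_shortExact {f : A →ₗ[R] B} {g : B →ₗ[R] D}
    (h : Function.Exact f g) (hf : Function.Injective f) (hg : Function.Surjective g) :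
    (FGModuleCat.shortComplex f g h).ShortExact :=
  (FGModuleCat.shortExact_iff _).mpr ⟨hf, h, hg⟩

variable {X S : ObjectProperty (FGModuleCat.{u} R)}

theorem IsAdditiveSubcategory.of_linearEquiv (hX : IsAdditiveSubcategory X) (e : A ≃ₗ[R] B)
    (h : X (.of R A)) : X (.of R B) :=
  hX.closedUnderIsomorphisms.of_iso e.toFGModuleCatIso h

theorem IsAdditiveSubcategory.of_subsingleton (hX : IsAdditiveSubcategory X) [Subsingleton A] :
    X (.of R A) := by
  obtain ⟨Z, hZ, h⟩ := hX.containsZero.exists_zero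
  have hA : Limits.IsZero (FGModuleCat.of R A) := by
    rw [Limits.IsZero.iff_id_eq_zero]
    exact FGModuleCat.hom_ext (LinearMap.ext fun x => Subsingleton.elim (α := A) _ _)
  exact hX.closedUnderIsomorphisms.of_iso (hZ.iso hA) h

namespace IsTorsionfreeClass

theorem of_injective (hX : IsTorsionfreeClass X) (f : A →ₗ[R] B) (hf : Function.Injective f)
    (h : X (.of R B)) : X (.of R A) := by
  have : Mono (FGModuleCat.ofHom f) :=
    (forget₂ (FGModuleCat.{u} R) (ModuleCat.{u} R)).mono_of_mono_map
      ((ModuleCat.mono_iff_injective _).mpr hf)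
  exact hX.closedUnderSubobjects.prop_of_mono (FGModuleCat.ofHom f) h

theorem of_exact (hX : IsTorsionfreeClass X) {f : A →ₗ[R] B} {g : B →ₗ[R] D}
    (h : Function.Exact f g) (hf : Function.Injective f) (hg : Function.Surjective g)
    (hA : X (.of R A)) (hD : X (.of R D)) : X (.of R B) :=
  hX.closedUnderExtensions.prop_X₂_of_shortExact
    (FGModuleCat.shortComplex_shortExact h hf hg) hA hD

theorem pi (hX : IsTorsionfreeClass X) (h : X (.of R A)) (n : ℕ) :
    X (.of R (Fin n → A)) := by
  induction n with
  | zero => exact hX.additive.of_subsingleton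
  | succ n ih =>
    refine hX.additive.of_linearEquiv (Fin.consLinearEquiv R (fun _ : Fin (n + 1) => A)) ?_
    exact hX.of_exact (f := LinearMap.inl R A (Fin n → A)) (g := LinearMap.snd R A (Fin n → A))
      .inl_snd LinearMap.inl_injective LinearMap.snd_surjective h ih

theorem quotient_mem (hX : IsTorsionfreeClass X) {q : PrimeSpectrum R}
    (hq : q ∈ subcategoryAss R X) : X (.of R (R ⧸ q.asIdeal)) := by
  obtain ⟨M, hM, hqM⟩ := hq
  obtain ⟨-, f, hf⟩ := (isAssociatedPrime_iff_exists_injective_linearMap q.asIdeal M).mp hqM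
  exact hX.of_injective f hf hM

/-- A torsionfree class contains each finitely generated module all of whose associated primes
are associated primes of the class. -/
theorem modAss_le (hX : IsTorsionfreeClass X) : modAss R (subcategoryAss R X) ≤ X := by
  intro M hM
  suffices H : ∀ N : Submodule R M, (∀ q : PrimeSpectrum R, IsAssociatedPrime q.asIdeal (M ⧸ N) →
      q ∈ subcategoryAss R X) → X (.of R (M ⧸ N)) by
    refine hX.additive.of_linearEquiv (Submodule.quotEquivOfEqBot (⊥ : Submodule R M) rfl)
      (H ⊥ fun q hq => hM ?_)
    exact ((Submodule.quotEquivOfEqBot (⊥ : Submodule R M) rfl).isAssociatedPrime_iff).mp hq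
  intro N
  induction N using WellFoundedGT.induction with
  | ind N ih =>
  intro hN
  rcases subsingleton_or_nontrivial (M ⧸ N) with _ | _
  · exact hX.additive.of_subsingleton
  -- Maximality of `p` forces `p` to be the only associated prime of the `p`-torsion `K`, so `K`
  -- embeds in a power of `R ⧸ p`.
  obtain ⟨p, hp, hmax⟩ := wellFounded_gt.has_min (associatedPrimes R (M ⧸ N))
    (associatedPrimes.nonempty R (M ⧸ N))
  have := hp.isPrime
  let K := Submodule.torsionBySet R (M ⧸ N) p
  have hK : X (.of R K) := by
    obtain ⟨n, f, hf⟩ := exists_injective_pi_quotient_prime (M := K) p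
      (fun a ha x => Subtype.ext
        ((Submodule.mem_torsionBySet_iff _ _).mp x.2 ⟨a, ha⟩)) fun q hq => by
        have hpq : p ≤ q := by
          obtain ⟨-, x, rfl⟩ := isAssociatedPrime_iff.mp hq
          intro a ha
          exact Submodule.mem_colon_singleton.mpr (Subtype.ext
            ((Submodule.mem_torsionBySet_iff _ _).mp x.2 ⟨a, ha⟩))
        by_contra hne
        exact hmax q (hq.map_of_injective K.subtype Subtype.val_injective)
          (lt_of_le_of_ne hpq (Ne.symm hne))
    exact hX.of_injective f hf (hX.pi
      (hX.quotient_mem (q := ⟨p, hp.isPrime⟩) (hN ⟨p, hp.isPrime⟩ hp)) n)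
  let N' := K.comap N.mkQ
  have hNN' : N ≤ N' := fun x hx => by
    have : N.mkQ x = 0 := (Submodule.Quotient.mk_eq_zero _).mpr hx
    simp [N', Submodule.mem_comap, this]
  have hmap : N'.map N.mkQ = K := Submodule.map_comap_eq_of_surjective N.mkQ_surjective K
  have hlt : N < N' := by
    refine lt_of_le_of_ne hNN' fun heq => ?_
    have hbot : K = ⊥ := by rw [← hmap, ← heq]; exact N.mkQ_map_self
    obtain ⟨-, x, hx⟩ := isAssociatedPrime_iff.mp hp
    have hxK : x ∈ K := (Submodule.mem_torsionBySet_iff _ _).mpr fun a =>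
      Submodule.mem_colon_singleton.mp (hx.le a.2)
    rw [hbot, Submodule.mem_bot] at hxK
    subst hxK
    exact hp.isPrime.ne_top (by rw [hx, Submodule.colon_singleton_zero])
  let e : (M ⧸ N') ≃ₗ[R] ((M ⧸ N) ⧸ K) :=
    (Submodule.quotientQuotientEquivQuotient N N' hNN').symm ≪≫ₗ
      Submodule.quotEquivOfEq _ _ hmap
  refine hX.of_exact (f := K.subtype) (g := K.mkQ) (LinearMap.exact_subtype_mkQ K)
    Subtype.val_injective K.mkQ_surjective hK
    (hX.additive.of_linearEquiv e (ih N' hlt fun q hq => hN q ?_))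
  exact (e.isAssociatedPrime_iff.mp hq).of_quotient_torsionBySet

end IsTorsionfreeClass

/-! ### From a Serre subcategory to its primes and back. -/

namespace IsSerreSubcategoryOf

theorem mem_iff_of_exact (hS : IsSerreSubcategoryOf X S) {f : A →ₗ[R] B} {g : B →ₗ[R] D}
    (h : Function.Exact f g) (hf : Function.Injective f) (hg : Function.Surjective g)
    (hA : X (.of R A)) (hB : X (.of R B)) (hD : X (.of R D)) :
    S (.of R B) ↔ S (.of R A) ∧ S (.of R D) :=
  hS.mem_iff_of_conflation (FGModuleCat.shortComplex f g h)
    ⟨FGModuleCat.shortComplex_shortExact h hf hg, hA, hB, hD⟩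

omit [Module.Finite R B] in
theorem range_mem (hX : IsTorsionfreeClass X) (hS : IsSerreSubcategoryOf X S) (f : A →ₗ[R] B)
    (hA : S (.of R A)) (hf : X (.of R (LinearMap.range f))) : S (.of R (LinearMap.range f)) := by
  have hXA := hS.le _ hA
  refine ((hS.mem_iff_of_exact (f := (LinearMap.ker f).subtype) (g := f.rangeRestrict) ?_
    Subtype.val_injective f.surjective_rangeRestrict
    (hX.of_injective (LinearMap.ker f).subtype Subtype.val_injective hXA) hXA hf).mp hA).2
  rw [LinearMap.exact_iff, LinearMap.ker_rangeRestrict, Submodule.range_subtype]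

theorem isSpecializationClosedIn_subcategoryAss (hX : IsTorsionfreeClass X)
    (hS : IsSerreSubcategoryOf X S) :
    IsSpecializationClosedIn (subcategoryAss R X) (subcategoryAss R S) := by
  refine ⟨fun p ⟨M, hM, hp⟩ => ⟨M, hS.le _ hM, hp⟩, ?_⟩
  rintro ⟨p, _⟩ ⟨q, hq⟩ hpq ⟨L, hL, hp⟩
  have hpq : p ≤ q := (PrimeSpectrum.le_iff_specializes p q).mpr
    (Topology.IsInducing.subtypeVal.specializes_iff.mpr hpq)
  obtain ⟨f, hf⟩ := exists_linearMap_quotient_prime_ne_zero (M := L) q.asIdeal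
    (hp.module_annihilator_le.trans hpq)
  exact ⟨.of R (LinearMap.range f), hS.range_mem hX f hL
    (hX.of_injective (LinearMap.range f).subtype Subtype.val_injective (hX.quotient_mem hq)),
    isAssociatedPrime_range_quotient_prime q.asIdeal f hf⟩

/-- If `S N` for a proper submodule `N` of `M` such that a module of `S` has a nonzero map to
`M / N`, then `N` can be enlarged within `S`. -/
theorem exists_gt_mem (hX : IsTorsionfreeClass X) (hS : IsSerreSubcategoryOf X S)
    (hB : X (.of R B)) (N : Submodule R B) (hN : S (.of R N)) (hA : S (.of R A))
    (f : A →ₗ[R] B ⧸ N) (hf : f ≠ 0) : ∃ N' > N, S (.of R N') := by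
  -- `P` is the pullback of `A` and `B` over `B ⧸ N`, an extension of `A` by `N`. Its image in `B`
  -- is the new submodule; this avoids asking that `B ⧸ N` lie in `X`.
  let P := LinearMap.ker (N.mkQ ∘ₗ LinearMap.fst R B A - f ∘ₗ LinearMap.snd R B A)
  have hP : ∀ x, x ∈ P ↔ N.mkQ x.1 = f x.2 := fun x => by
    simp [P, LinearMap.mem_ker, sub_eq_zero]
  have hN0 : ∀ n : N, ((n : B), (0 : A)) ∈ P := fun n => by simp [hP]
  let i : N →ₗ[R] P := (LinearMap.inl R B A ∘ₗ N.subtype).codRestrict P hN0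
  let π : P →ₗ[R] A := LinearMap.snd R B A ∘ₗ P.subtype
  let ρ : P →ₗ[R] B := LinearMap.fst R B A ∘ₗ P.subtype
  have hi : Function.Injective i := fun a b h => Subtype.ext congr(($h : B × A).1)
  have hπ : Function.Surjective π := fun a => by
    obtain ⟨b, hb⟩ := N.mkQ_surjective (f a)
    exact ⟨⟨(b, a), (hP _).mpr hb⟩, rfl⟩
  have hex : Function.Exact i π := by
    rintro ⟨⟨b, a⟩, h⟩
    constructor
    · intro ha
      obtain rfl : a = 0 := ha
      refine ⟨⟨b, ?_⟩, rfl⟩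
      have := (hP _).mp h
      rw [map_zero] at this
      exact (Submodule.Quotient.mk_eq_zero _).mp this
    · rintro ⟨n, hn⟩
      rw [← hn]
      rfl
  have hPX : X (.of R P) := hX.of_exact hex hi hπ (hS.le _ hN) (hS.le _ hA)
  have hPS : S (.of R P) :=
    (hS.mem_iff_of_exact hex hi hπ (hS.le _ hN) hPX (hS.le _ hA)).mpr ⟨hN, hA⟩
  refine ⟨LinearMap.range ρ, lt_of_le_of_ne (fun n hn => ⟨⟨_, hN0 ⟨n, hn⟩⟩, rfl⟩) ?_,
    hS.range_mem hX ρ hPS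
      (hX.of_injective (LinearMap.range ρ).subtype Subtype.val_injective hB)⟩
  intro heq
  refine hf (LinearMap.ext fun a => ?_)
  obtain ⟨b, hb⟩ := N.mkQ_surjective (f a)
  have hbN : b ∈ N := heq ▸ (⟨⟨(b, a), (hP _).mpr hb⟩, rfl⟩ : b ∈ LinearMap.range ρ)
  rw [← hb]
  exact (Submodule.Quotient.mk_eq_zero _).mpr hbN

theorem modAss_le (hX : IsTorsionfreeClass X) (hS : IsSerreSubcategoryOf X S) :
    modAss R (subcategoryAss R S) ≤ S := by
  intro M hM
  have hXM : X M := hX.modAss_le M fun p hp =>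
    (hS.isSpecializationClosedIn_subcategoryAss hX).1 (hM hp)
  obtain ⟨N, hN, hmax⟩ := wellFounded_gt.has_min {N : Submodule R M | S (.of R N)}
    ⟨⊥, hS.additive.of_subsingleton⟩
  rcases eq_or_ne N ⊤ with rfl | hne
  · exact hS.additive.of_linearEquiv Submodule.topEquiv hN
  exfalso
  have : Nontrivial (M ⧸ N) := Submodule.Quotient.nontrivial_iff.mpr hne
  obtain ⟨q, hq⟩ := associatedPrimes.nonempty R (M ⧸ N)
  obtain ⟨hqp, i, hi⟩ := (isAssociatedPrime_iff_exists_injective_linearMap q _).mp hq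
  have hann : Module.annihilator R M ≤ q :=
    (LinearMap.annihilator_le_of_surjective N.mkQ N.mkQ_surjective).trans
      hq.module_annihilator_le
  -- `q` need not lie in `Ass M`, but it contains some `p` that does; the object `L` of `S` with `p
  -- ∈ Ass L` then maps nontrivially to `R ⧸ q ⊆ M ⧸ N`.
  obtain ⟨p, hpq, hp⟩ := exists_isAssociatedPrime_le q hann
  obtain ⟨L, hL, hpL⟩ := hM (show (⟨p, hp.isPrime⟩ : PrimeSpectrum R) ∈ moduleAss R M from hp)
  obtain ⟨f, hf⟩ := exists_linearMap_quotient_prime_ne_zero (M := L) q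
    (hpL.module_annihilator_le.trans hpq)
  obtain ⟨N', hlt, hN'⟩ := hS.exists_gt_mem hX (B := M) hXM N hN hL (i ∘ₗ f) fun h => hf <|
    LinearMap.ext fun x => hi (by simpa using congr($h x))
  exact hmax N' hN' hlt

theorem modAss_subcategoryAss (hX : IsTorsionfreeClass X) (hS : IsSerreSubcategoryOf X S) :
    modAss R (subcategoryAss R S) = S :=
  le_antisymm (hS.modAss_le hX) fun M hM _ hp => ⟨M, hM, hp⟩

end IsSerreSubcategoryOf

/-! ### From a set of primes to a Serre subcategory. -/

theorem moduleAss_middle_subset {T : ShortComplex (FGModuleCat.{u} R)} (hT : T.ShortExact) :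
    moduleAss R T.X₂ ⊆ moduleAss R T.X₁ ∪ moduleAss R T.X₃ := by
  obtain ⟨h1, h2, -⟩ := (FGModuleCat.shortExact_iff T).mp hT
  exact fun p hp => associatedPrimes.subset_union_of_exact h1 h2 hp

theorem isAdditiveSubcategory_modAss (Φ : Set (PrimeSpectrum R)) :
    IsAdditiveSubcategory (modAss R Φ) where
  closedUnderIsomorphisms := ⟨fun e h _ hp =>
    h ((FGModuleCat.isoToLinearEquiv e).isAssociatedPrime_iff.mpr hp)⟩
  containsZero := ⟨.of R PUnit, by
    rw [Limits.IsZero.iff_id_eq_zero]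
    exact FGModuleCat.hom_ext (LinearMap.ext fun x => Subsingleton.elim (α := PUnit) _ _),
    fun _ hp => (not_isAssociatedPrime_of_subsingleton (M := PUnit) hp).elim⟩
  biprod_mem M N hM hN := (moduleAss_middle_subset
    (ShortComplex.Splitting.ofHasBinaryBiproduct M N).shortExact).trans (Set.union_subset hM hN)

theorem isSerreSubcategoryOf_modAss (hX : IsTorsionfreeClass X) {Φ : Set (PrimeSpectrum R)}
    (hΦ : IsSpecializationClosedIn (subcategoryAss R X) Φ) :
    IsSerreSubcategoryOf X (modAss R Φ) where
  le M hM := hX.modAss_le M (hM.trans hΦ.1)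
  additive := isAdditiveSubcategory_modAss Φ
  mem_iff_of_conflation T hT := by
    obtain ⟨h1, h2, h3⟩ := (FGModuleCat.shortExact_iff T).mp hT.shortExact
    refine ⟨fun h => ⟨fun p hp => h (hp.map_of_injective _ h1), fun q hq => ?_⟩,
      fun h => (moduleAss_middle_subset hT.shortExact).trans (Set.union_subset h.1 h.2)⟩
    -- A prime in `Ass` of the quotient specializes one in `Ass` of the middle term, and it lies in
    -- `Ass X` because the quotient is in `X`.
    have hann : Module.annihilator R T.X₂ ≤ q.asIdeal :=
      (LinearMap.annihilator_le_of_surjective T.g.hom.hom h3).trans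
        hq.module_annihilator_le
    obtain ⟨p, hpq, hp⟩ := exists_isAssociatedPrime_le q.asIdeal hann
    have hpΦ : (⟨p, hp.isPrime⟩ : PrimeSpectrum R) ∈ Φ := h hp
    have hqX : q ∈ subcategoryAss R X := ⟨T.X₃, hT.right_mem, hq⟩
    exact hΦ.2 (x := ⟨_, hΦ.1 hpΦ⟩) (y := ⟨q, hqX⟩)
      (Topology.IsInducing.subtypeVal.specializes_iff.mp
        ((PrimeSpectrum.le_iff_specializes _ q).mp hpq)) hpΦ

theorem subcategoryAss_modAss (Φ : Set (PrimeSpectrum R)) :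
    subcategoryAss R (modAss R Φ) = Φ := by
  refine Set.Subset.antisymm (fun p ⟨M, hM, hp⟩ => hM hp) fun p hp => ?_
  refine ⟨.of R (R ⧸ p.asIdeal), fun q hq => ?_,
    (isAssociatedPrime_iff_exists_injective_linearMap p.asIdeal _).mpr
      ⟨p.2, LinearMap.id, Function.injective_id⟩⟩
  rwa [PrimeSpectrum.ext (IsAssociatedPrime.eq_of_quotient_prime (p := p.asIdeal) hq)]

end Subcategories

theorem mainTheorem10 (R : Type u) [CommRing R] [IsNoetherianRing R]
    (X : ObjectProperty (FGModuleCat.{u} R)) (hX : IsTorsionfreeClass X) :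
    Set.BijOn (subcategoryAss R)
        {S | IsSerreSubcategoryOf X S}
        {Φ | IsSpecializationClosedIn (subcategoryAss R X) Φ} ∧
      Set.BijOn (modAss R)
        {Φ | IsSpecializationClosedIn (subcategoryAss R X) Φ}
        {S | IsSerreSubcategoryOf X S} ∧
      Set.InvOn (modAss R) (subcategoryAss R)
        {S | IsSerreSubcategoryOf X S}
        {Φ | IsSpecializationClosedIn (subcategoryAss R X) Φ} := by
  have hinv : Set.InvOn (modAss R) (subcategoryAss R) {S | IsSerreSubcategoryOf X S}
      {Φ | IsSpecializationClosedIn (subcategoryAss R X) Φ} :=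
    ⟨fun _ hS => hS.modAss_subcategoryAss hX, fun Φ _ => subcategoryAss_modAss Φ⟩
  have h1 : Set.MapsTo (subcategoryAss R) {S | IsSerreSubcategoryOf X S}
      {Φ | IsSpecializationClosedIn (subcategoryAss R X) Φ} :=
    fun _ hS => hS.isSpecializationClosedIn_subcategoryAss hX
  have h2 : Set.MapsTo (modAss R) {Φ | IsSpecializationClosedIn (subcategoryAss R X) Φ}
      {S | IsSerreSubcategoryOf X S} :=
    fun _ hΦ => isSerreSubcategoryOf_modAss hX hΦ
  exact ⟨hinv.bijOn h1 h2, hinv.symm.bijOn h2 h1, hinv⟩
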